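/- Let $1\le k\le n$. A fork-join queue with $m$ nodes is given by an arrival process of jobs (the inter-arrival times $\ge 0$ of jobs $0,1,2,\dots$) and by service times $S_a^j\ge 0$ for the sub-task of job $j$ at node $a\in\{1,\dots,m\}$. On arrival a job is forked into $m$ sub-tasks, one for each node; every node serves its own sub-queue (unlimited capacity, initially empty) first come first served, and no sub-task is ever removed. Let $t_a^j$ be the sojourn time (completion time minus arrival time) of the $a$-th sub-task of job $j$. The stable sojourn times $(t_1,\dots,t_m)$ are a random vector to which $(t_1^j,\dots,t_m^j)$ converges in distribution as $j\to\infty$, if there is one; the queue is then called stable. In the non-purging $(m,k)$ fork-join queue a job is done when $k$ of its $m$ sub-tasks are completed, and the stationary job sojourn time $t_{(m,k)}$ is the limit in distribution of the sojourn time of job $j$ as $j\to\infty$; the basic $(m,m)$ fork-join queue is the case $k=m$. Consider a non-purging $(n,k)$ fork-join queue that is stable and homogeneous: for every $l\le n$, any $l$ nodes have the same joint law of the arrival process and their service times. (Independence of the service times is not required; the condition holds if all service times are independent of each other and of the arrival process and, for each job, those of its sub-tasks are identically distributed.) For $k\le i\le n$ consider an equivalent basic $(i,i)$ fork-join queue,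 i.e. one with the same arrival process and the same service time distribution, in the sense that the joint law of the arrival process and of the service times at any $l\le i$ of its nodes is the same as for any $l$ nodes of the $(n,k)$ queue (in the independent case: the same law of the arrival process and the same law of a single service time, for each job). Then these basic queues are stable, the stationary job sojourn times $t_{(n,k)}$ and $t_{(i,i)}$, $k\le i\le n$, exist, $t_{(n,k)}$ is distributed as the $k$-th smallest of the stable sojourn times $t_1,\dots,t_n$ of the $(n,k)$ queue and $t_{(i,i)}$ as the largest of the stable sojourn times of the $(i,i)$ queue, and $t_{(n,k)}=\sum_{i=k}^n W_i^{n,k}\,t_{(i,i)}$ in the sense of distributions, that is, $$P(t_{(n,k)}\le x)=\sum_{i=k}^{n}W_i^{n,k}\,P(t_{(i,i)}\le x)\qquad\text{for all }x\in\mathbb R,$$ where $$W_i^{n,k}=\sum_{j=k}^{i}\binom nj A_i^{n,j},\qquad A_j^{n,j}=1,\qquad A_i^{n,j}=-\sum_{r=1}^{i-j}\binom{n-i+r}{r}A_{i-r}^{n,j}\quad(j<i\le n).$$ -/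

import Mathlib

open MeasureTheory ProbabilityTheory Filter
open scoped NNReal

noncomputable section

/-! ### Order statistics and the coefficients -/

/-- The `k`-th order statistic `x_{(n,k)}` of `x_1, …, x_n`, that is, the `k`-th smallest of them,
for `1 ≤ k ≤ n` (and `0` for all other `k`, which are never used).
In particular `orderStat n x` is the maximum of `x_1, …, x_n` if `1 ≤ n`. -/
def orderStat {n : ℕ} (k : ℕ) (x : Fin n → ℝ) : ℝ :=
  if h : 1 ≤ k ∧ k ≤ n then x (Tuple.sort x ⟨k - 1, by omega⟩) else 0

/-- The numbers `A_i^{n,k}`, `k ≤ i ≤ n`:  `A_k^{n,k} = 1` and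
`A_i^{n,k} = - ∑_{j=1}^{i-k} (n-i+j choose j) A_{i-j}^{n,k}` for `k < i ≤ n`.
The summation variable `j : Fin (i - k)` stands for `j + 1`. -/
def coeffA (n k i : ℕ) : ℤ :=
  if i = k then 1
  else -∑ j : Fin (i - k),
    ((n - i + (j.val + 1)).choose (j.val + 1) : ℤ) * coeffA n k (i - (j.val + 1))
termination_by i
decreasing_by have := j.isLt; omega

/-- The `W` coefficient `W_i^{n,k} = ∑_{j=k}^{i} (n choose j) A_i^{n,j}`. -/
def coeffW (n k i : ℕ) : ℤ :=
  ∑ j ∈ Finset.Icc k i, (n.choose j : ℤ) * coeffA n j i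

/-! ### Fork-join queues -/

/-- The data of a fork-join queue with `n` nodes on a probability space `(Ω, P)`:
the inter-arrival times of the jobs `0, 1, 2, …` (the first one is the arrival time of job `0`),
and the service time of the sub-task of job `j` at node `m`.  No independence is built in. -/
structure ForkJoinQueue (n : ℕ) {Ω : Type*} [MeasurableSpace Ω] (P : Measure Ω) where
  /-- the time between the arrivals of jobs `j - 1` and `j` -/
  interarrival : ℕ → Ω → ℝ≥0
  /-- the service time of the sub-task of job `j` that is assigned to node `m` -/
  service : ℕ → Fin n → Ω → ℝ≥0
  measurable_interarrival : ∀ j, Measurable (interarrival j)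
  measurable_service : ∀ j m, Measurable (service j m)

namespace ForkJoinQueue

variable {n n' : ℕ} {Ω Ω' : Type*} [MeasurableSpace Ω] [MeasurableSpace Ω']
  {P : Measure Ω} {P' : Measure Ω'}

/-- The arrival time of job `j`, when it is forked into one sub-task for every node. -/
def arrival (Q : ForkJoinQueue n P) (j : ℕ) (ω : Ω) : ℝ :=
  ∑ l ∈ Finset.range (j + 1), (Q.interarrival l ω : ℝ)

/-- The time at which node `m` completes its sub-task of job `j`.  The nodes serve their own
sub-queues, of unlimited capacity, first come first served, and are empty before job `0`;
a sub-task enters service as soon as it has arrived and the node has completed the sub-task of the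
previous job.  Sub-tasks are never removed (non-purging), so that this does not depend
on when a job counts as done. -/
def completion (Q : ForkJoinQueue n P) : ℕ → Fin n → Ω → ℝ
  | 0, m, ω => Q.arrival 0 ω + Q.service 0 m ω
  | j + 1, m, ω => max (Q.arrival (j + 1) ω) (Q.completion j m ω) + Q.service (j + 1) m ω

/-- The sojourn times `t_1^j, …, t_n^j` of the `n` sub-tasks of job `j`. -/
def sojourn (Q : ForkJoinQueue n P) (j : ℕ) (ω : Ω) : Fin n → ℝ :=
  fun m => Q.completion j m ω - Q.arrival j ω

/-- The sojourn time of job `j` if the queue is run as a non-purging `(n, k)` fork-join queue: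
the job is done as soon as `k` of its `n` sub-tasks are completed.
For `k = n` this is the basic `(n, n)` fork-join queue. -/
def jobSojourn (Q : ForkJoinQueue n P) (k : ℕ) (j : ℕ) (ω : Ω) : ℝ :=
  orderStat k (fun m => Q.completion j m ω) - Q.arrival j ω

/-- `τ` is the joint law of the stable (stationary) sojourn times `t_1, …, t_n` of the sub-tasks:
`(t_1^j, …, t_n^j)` converges in distribution to `τ` as `j → ∞`. -/
def IsStableSojournLaw [IsProbabilityMeasure P] (Q : ForkJoinQueue n P)
    (τ : Measure (Fin n → ℝ)) [IsProbabilityMeasure τ] : Prop :=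
  TendstoInDistribution Q.sojourn atTop id (fun _ => P) τ

/-- The input of the sub-queues `e 0, …, e (l - 1)`: the arrival process of the jobs, and the
service times at these nodes. -/
def input (Q : ForkJoinQueue n P) {l : ℕ} (e : Fin l → Fin n) (ω : Ω) :
    (ℕ → ℝ≥0) × (ℕ × Fin l → ℝ≥0) :=
  (fun j => Q.interarrival j ω, fun p => Q.service p.1 (e p.2) ω)

/-- Two fork-join queues, possibly with different numbers of nodes, are equivalent if they have the
same job arrival process and the same service time distribution, in law: any `l` sub-queues of the
first one and any `l` sub-queues of the second one have inputs of the same law.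
If all service times are independent of each other and of the arrival process, this just means
that the laws of the arrival processes agree and that the service times have the same law, see
`equivalent_of_independent`. -/
def Equivalent (Q : ForkJoinQueue n P) (R : ForkJoinQueue n' P') : Prop :=
  ∀ (l : ℕ) (e : Fin l ↪ Fin n) (f : Fin l ↪ Fin n'),
    IdentDistrib (Q.input e) (R.input f) P P'

/-- A fork-join queue is homogeneous if its service times are jointly identical over the nodes:
any `l` nodes, in any order, have the same joint law of service times
(together with the arrival process). -/
def IsHomogeneous (Q : ForkJoinQueue n P) : Prop := Q.Equivalent Q

/-- All service times are independent of each other and of the arrival process. -/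
structure IsIndependent (Q : ForkJoinQueue n P) : Prop where
  service_indep : iIndepFun (fun (p : ℕ × Fin n) => Q.service p.1 p.2) P
  arrival_indep : IndepFun (fun ω j => Q.interarrival j ω)
    (fun ω (p : ℕ × Fin n) => Q.service p.1 p.2 ω) P

theorem measurable_input (Q : ForkJoinQueue n P) {l : ℕ} (e : Fin l → Fin n) :
    Measurable (Q.input e) :=
  Measurable.prodMk (measurable_pi_lambda _ fun j => Q.measurable_interarrival j)
    (measurable_pi_lambda _ fun p => Q.measurable_service p.1 (e p.2))

theorem IsIndependent.map_input [IsProbabilityMeasure P] {Q : ForkJoinQueue n P}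
    (hQ : Q.IsIndependent) {l : ℕ} (e : Fin l ↪ Fin n) :
    P.map (Q.input e) = (P.map (fun ω j => Q.interarrival j ω)).prod
      (Measure.infinitePi (fun p : ℕ × Fin l => P.map (Q.service p.1 (e p.2)))) := by
  have h1 : iIndepFun (fun (p : ℕ × Fin l) => Q.service p.1 (e p.2)) P :=
    hQ.service_indep.precomp (g := fun p : ℕ × Fin l => (p.1, e p.2))
      (fun p q h => by
        have h' := Prod.mk.inj h
        exact Prod.ext h'.1 (e.injective h'.2))
  have hψ : Measurable fun (s : ℕ × Fin n → ℝ≥0) (p : ℕ × Fin l) => s (p.1, e p.2) :=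
    measurable_pi_lambda _ fun p => measurable_pi_apply _
  have h2 : IndepFun (fun ω j => Q.interarrival j ω)
      (fun ω (p : ℕ × Fin l) => Q.service p.1 (e p.2) ω) P :=
    hQ.arrival_indep.comp measurable_id hψ
  rw [← h1.map_fun_eq_infinitePi_map (fun p => Q.measurable_service _ _)]
  exact (indepFun_iff_map_prod_eq_prod_map_map
    (measurable_pi_lambda _ fun j => Q.measurable_interarrival j).aemeasurable
    (measurable_pi_lambda _ fun p => Q.measurable_service _ _).aemeasurable).1 h2

/-- In the independent case two queues are equivalent as soon as they have the same arrival process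
and the same one-dimensional service time distribution (at every job). -/
theorem equivalent_of_independent [IsProbabilityMeasure P] [IsProbabilityMeasure P']
    (Q : ForkJoinQueue n P) (R : ForkJoinQueue n' P')
    (hQ : Q.IsIndependent) (hR : R.IsIndependent)
    (harr : IdentDistrib (fun ω j => Q.interarrival j ω) (fun ω j => R.interarrival j ω) P P')
    (hserv : ∀ j m m', IdentDistrib (Q.service j m) (R.service j m') P P') :
    Q.Equivalent R := by
  intro l e f
  refine ⟨(Q.measurable_input e).aemeasurable, (R.measurable_input f).aemeasurable, ?_⟩
  rw [hQ.map_input e, hR.map_input f, harr.map_eq]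
  congr 2
  funext p
  exact (hserv _ _ _).map_eq

end ForkJoinQueue

end

/-! Fix `x` and let `b` be the number of sojourn times at most `x`. The `k`-th smallest is at most
`x` iff `k ≤ b`, while exactly `b.choose i` of the `i`-subsets of nodes have their maximum at most
`x`. Binomial inversion writes the indicator of `k ≤ b` as a combination of the `b.choose i`
(`sum_choose_mul_altCoeff`). Integrating gives `measureReal_orderStat_le`; by homogeneity all
`n.choose i` subsets of size `i` contribute equally, which produces `coeffW` (`coeffW_eq`). On the
probabilistic side, sojourn times at a set of nodes are a fixed measurable function of the input
there, so equivalent queues have equal sojourn laws at each job. These equalities pass to the limit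
by continuous mapping and uniqueness of limits. -/

open Finset Topology

/-! ### Order statistics -/

/-- The `k`-th smallest entry is at most `x` iff at least `k` entries are at most `x`. -/
theorem orderStat_le_iff {n k : ℕ} (hk : 1 ≤ k) (hkn : k ≤ n) (t : Fin n → ℝ) (x : ℝ) :
    orderStat k t ≤ x ↔ k ≤ #{m | t m ≤ x} := by
  have h := Tuple.lt_card_le_iff_apply_le_of_monotone (j := (⟨k - 1, by omega⟩ : Fin n)) (a := x)
    (Tuple.monotone_sort t)
  have hc : #{m | (t ∘ Tuple.sort t) m ≤ x} = #{m | t m ≤ x} :=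
    Finset.card_equiv (Tuple.sort t) (by simp)
  rw [hc] at h
  rw [orderStat, dif_pos ⟨hk, hkn⟩]
  simp only [Function.comp_apply] at h
  rw [← h]
  omega

theorem orderStat_self_le_iff {n : ℕ} (hn : 1 ≤ n) (t : Fin n → ℝ) (x : ℝ) :
    orderStat n t ≤ x ↔ ∀ m, t m ≤ x := by
  have hle := Finset.card_filter_le (univ : Finset (Fin n)) (fun m => t m ≤ x)
  have heq := Finset.card_filter_eq_iff (s := (univ : Finset (Fin n))) (p := fun m => t m ≤ x)
  simp only [Finset.card_univ, Fintype.card_fin, mem_univ, true_imp_iff] at hle heq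
  rw [orderStat_le_iff hn le_rfl, ← heq]
  omega

/-- Monotonicity and translation in one inequality; shift equivariance and the sup-norm Lipschitz
bound both follow from it. -/
theorem orderStat_le_orderStat_add {n k : ℕ} (hk : 1 ≤ k) (hkn : k ≤ n) {s t : Fin n → ℝ} {c : ℝ}
    (h : ∀ m, t m ≤ s m + c) : orderStat k t ≤ orderStat k s + c := by
  rw [orderStat_le_iff hk hkn]
  refine ((orderStat_le_iff hk hkn s _).1 le_rfl).trans (Finset.card_le_card fun m hm => ?_)
  simp only [mem_filter, mem_univ, true_and] at hm ⊢
  linarith [h m]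

theorem orderStat_sub_const {n k : ℕ} (hk : 1 ≤ k) (hkn : k ≤ n) (t : Fin n → ℝ) (c : ℝ) :
    orderStat k (fun m => t m - c) = orderStat k t - c := by
  apply le_antisymm
  · simpa [sub_eq_add_neg] using
      orderStat_le_orderStat_add hk hkn (s := t) (t := fun m => t m - c) (c := -c)
        fun m => (sub_eq_add_neg _ _).le
  · have := orderStat_le_orderStat_add hk hkn (s := fun m => t m - c) (t := t) (c := c)
      fun m => by simp
    linarith

theorem lipschitzWith_orderStat {n k : ℕ} (hk : 1 ≤ k) (hkn : k ≤ n) :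
    LipschitzWith 1 (orderStat k : (Fin n → ℝ) → ℝ) := by
  refine LipschitzWith.of_le_add fun s t => orderStat_le_orderStat_add hk hkn fun m => ?_
  have := (Real.dist_eq _ _ ▸ dist_le_pi_dist s t m : |s m - t m| ≤ _)
  linarith [le_abs_self (s m - t m)]

theorem continuous_orderStat {n k : ℕ} (hk : 1 ≤ k) (hkn : k ≤ n) :
    Continuous (orderStat k : (Fin n → ℝ) → ℝ) :=
  (lipschitzWith_orderStat hk hkn).continuous

/-! ### The coefficients in closed form -/

/-- A vanishing alternating row sum of Pascal's triangle, with one extreme term split off. -/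
theorem sum_neg_one_pow_mul_choose_add_one (s : ℕ) (hs : 0 < s) :
    ∑ r ∈ range s, (-1 : ℤ) ^ (s - (r + 1)) * (s.choose (r + 1)) = -(-1) ^ s := by
  have h := Int.alternating_sum_range_choose_of_ne hs.ne'
  rw [Finset.sum_range_succ, Nat.choose_self, Nat.cast_one, mul_one] at h
  rw [← eq_neg_of_add_eq_zero_left h, ← Finset.sum_range_reflect]
  refine sum_congr rfl fun r hr => ?_
  have hr := mem_range.1 hr
  rw [show s - 1 - r + 1 = s - r by omega, show s - (s - r) = r by omega, Nat.choose_symm hr.le]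

theorem coeffA_eq {n j : ℕ} : ∀ {i : ℕ}, j ≤ i → i ≤ n →
    coeffA n j i = (-1) ^ (i - j) * ((n - j).choose (i - j)) := by
  intro i
  induction i using Nat.strong_induction_on with
  | _ i ih =>
    intro hji hin
    rw [coeffA]
    split_ifs with h
    · simp [h]
    obtain ⟨s, rfl⟩ := Nat.exists_eq_add_of_le hji
    have hs : 0 < s := by omega
    rw [Fin.sum_univ_eq_sum_range (fun r =>
      ((n - (j + s) + (r + 1)).choose (r + 1) : ℤ) * coeffA n j (j + s - (r + 1)))]
    have : ∀ r ∈ range s,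
        ((n - (j + s) + (r + 1)).choose (r + 1) : ℤ) * coeffA n j (j + s - (r + 1))
        = (n - j).choose s * ((-1 : ℤ) ^ (s - (r + 1)) * (s.choose (r + 1))) := by
      intro r hr
      have hr := mem_range.1 hr
      rw [ih _ (by omega) (by omega) (by omega),
        show j + s - (r + 1) - j = s - (r + 1) by omega]
      -- Trinomial revision frees one binomial factor from `r`, leaving the alternating sum above.
      have h1 := Nat.choose_mul (n := n - j) (k := s) (s := s - (r + 1)) (by omega)
      rw [show n - j - (s - (r + 1)) = n - (j + s) + (r + 1) by omega,
        show s - (s - (r + 1)) = r + 1 by omega, Nat.choose_symm (by omega : r + 1 ≤ s)] at h1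
      have h2 : ((n - j).choose s : ℤ) * s.choose (r + 1) = (n - j).choose (s - (r + 1)) *
          (n - (j + s) + (r + 1)).choose (r + 1) := by exact_mod_cast h1
      linear_combination -(-1 : ℤ) ^ (s - (r + 1)) * h2
    rw [show j + s - j = s by omega, sum_congr rfl this, ← mul_sum, sum_neg_one_pow_mul_choose_add_one s hs]
    ring

/-- `C(n, i)⁻¹ W_i^{n,k}`, which does not depend on `n`. -/
def altCoeff (k i : ℕ) : ℤ := ∑ j ∈ Icc k i, (-1) ^ (i - j) * (i.choose j : ℤ)

theorem coeffW_eq {n k i : ℕ} (hin : i ≤ n) : coeffW n k i = n.choose i * altCoeff k i := by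
  rw [coeffW, altCoeff, mul_sum]
  refine sum_congr rfl fun j hj => ?_
  have hji := (mem_Icc.1 hj).2
  rw [coeffA_eq hji hin]
  have h : (n.choose i : ℤ) * i.choose j = n.choose j * (n - j).choose (i - j) := by
    exact_mod_cast Nat.choose_mul (n := n) hji
  linear_combination -(-1 : ℤ) ^ (i - j) * h

/-- Inversion of the binomial transform. -/
theorem sum_choose_mul_choose_alternating (b j n : ℕ) (hbn : b ≤ n) :
    ∑ i ∈ Icc j n, (-1 : ℤ) ^ (i - j) * (b.choose i * i.choose j) = if b = j then 1 else 0 := by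
  rcases lt_or_ge b j with hj | hj
  · rw [if_neg hj.ne]
    refine sum_eq_zero fun i hi => ?_
    rw [Nat.choose_eq_zero_of_lt (hj.trans_le (mem_Icc.1 hi).1)]
    simp
  have hterm : ∀ i ∈ Icc j b, (-1 : ℤ) ^ (i - j) * (b.choose i * i.choose j) =
      b.choose j * ((-1) ^ (i - j) * (b - j).choose (i - j)) := by
    intro i hi
    have h : (b.choose i : ℤ) * i.choose j = b.choose j * (b - j).choose (i - j) := by
      exact_mod_cast Nat.choose_mul (n := b) (mem_Icc.1 hi).1
    linear_combination (-1 : ℤ) ^ (i - j) * h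
  have hsub : Icc j b ⊆ Icc j n := Icc_subset_Icc_right hbn
  -- Terms with `i > b` vanish; the others form the alternating row sum of order `b - j`, nonzero
  -- only for `b = j`.
  rw [← sum_subset hsub, sum_congr rfl hterm, ← mul_sum, ← Finset.Ico_add_one_right_eq_Icc,
    sum_Ico_eq_sum_range, show b + 1 - j = b - j + 1 by omega]
  · simp only [Nat.add_sub_cancel_left]
    rw [Int.alternating_sum_range_choose]
    rcases hj.eq_or_lt with rfl | hj
    · simp
    · rw [if_neg (by omega), if_neg (by omega), mul_zero]
  · intro i hi hib
    rw [Nat.choose_eq_zero_of_lt (by simp only [mem_Icc] at hi hib; omega)]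
    simp

/-- After exchanging the sums, inversion keeps only `j = b`, which lies in `Icc k n` iff `k ≤ b`. -/
theorem sum_choose_mul_altCoeff {k b n : ℕ} (hbn : b ≤ n) :
    ∑ i ∈ Icc k n, altCoeff k i * (b.choose i : ℤ) = if k ≤ b then 1 else 0 := by
  have h : ∑ i ∈ Icc k n, altCoeff k i * (b.choose i : ℤ) = ∑ j ∈ Icc k n, ∑ i ∈ Icc j n,
      (-1 : ℤ) ^ (i - j) * (b.choose i * i.choose j) := by
    simp only [altCoeff, sum_mul]
    rw [Finset.sum_comm' (s' := fun j => Icc j n) (t' := Icc k n)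
      (by intro i j; simp only [mem_Icc]; omega)]
    exact sum_congr rfl fun j _ => sum_congr rfl fun i _ => by ring
  rw [h, sum_congr rfl fun j _ => sum_choose_mul_choose_alternating b j n hbn, sum_ite_eq]
  simp [mem_Icc, hbn]

/-! ### Convergence in distribution -/

/-- Convergence in distribution depends only on the laws, so the probability spaces may be changed.
-/
theorem TendstoInDistribution.of_identDistrib {ι E Ω₁ Ω₂ : Type*} {Ω Ω' : ι → Type*}
    {m : ∀ i, MeasurableSpace (Ω i)} {m' : ∀ i, MeasurableSpace (Ω' i)}
    {μ : ∀ i, Measure (Ω i)} [∀ i, IsProbabilityMeasure (μ i)]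
    {μ' : ∀ i, Measure (Ω' i)} [∀ i, IsProbabilityMeasure (μ' i)]
    {m₁ : MeasurableSpace Ω₁} {ν : Measure Ω₁} [IsProbabilityMeasure ν]
    {m₂ : MeasurableSpace Ω₂} {ν' : Measure Ω₂} [IsProbabilityMeasure ν']
    {mE : MeasurableSpace E} [TopologicalSpace E] [OpensMeasurableSpace E]
    {X : ∀ i, Ω i → E} {Y : ∀ i, Ω' i → E} {Z : Ω₁ → E} {T : Ω₂ → E} {l : Filter ι}
    (h : TendstoInDistribution X l Z μ ν) (hXY : ∀ i, IdentDistrib (X i) (Y i) (μ i) (μ' i))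
    (hZT : IdentDistrib Z T ν ν') : TendstoInDistribution Y l T μ' ν' where
  forall_aemeasurable i := (hXY i).aemeasurable_snd
  aemeasurable_limit := hZT.aemeasurable_snd
  tendsto := by
    have h1 : (⟨ν'.map T, Measure.isProbabilityMeasure_map hZT.aemeasurable_snd⟩ :
        ProbabilityMeasure E) =
        ⟨ν.map Z, Measure.isProbabilityMeasure_map h.aemeasurable_limit⟩ :=
      Subtype.ext hZT.map_eq.symm
    have h2 : (fun i => (⟨(μ' i).map (Y i),
        Measure.isProbabilityMeasure_map (hXY i).aemeasurable_snd⟩ : ProbabilityMeasure E)) =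
        fun i => ⟨(μ i).map (X i), Measure.isProbabilityMeasure_map (h.forall_aemeasurable i)⟩ :=
      funext fun i => Subtype.ext (hXY i).map_eq.symm
    rw [h1, h2]
    exact h.tendsto

/-! ### Sojourn times -/

namespace ForkJoinQueue

variable {n n' : ℕ} {Ω Ω' : Type*} [MeasurableSpace Ω] [MeasurableSpace Ω']
  {P : Measure Ω} {P' : Measure Ω'}

/-- The fork-join queue on the space of all inputs. -/
def canonical (l : ℕ) : ForkJoinQueue l (0 : Measure ((ℕ → ℝ≥0) × (ℕ × Fin l → ℝ≥0))) where
  interarrival j ω := ω.1 j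
  service j m ω := ω.2 (j, m)
  measurable_interarrival j := (measurable_pi_apply j).comp measurable_fst
  measurable_service j m := (measurable_pi_apply (j, m)).comp measurable_snd

theorem measurable_arrival (Q : ForkJoinQueue n P) (j : ℕ) : Measurable (Q.arrival j) :=
  Finset.measurable_sum _ fun l _ => (Q.measurable_interarrival l).coe_nnreal_real

theorem measurable_completion (Q : ForkJoinQueue n P) (j : ℕ) (m : Fin n) :
    Measurable (Q.completion j m) := by
  induction j with
  | zero => exact (Q.measurable_arrival 0).add (Q.measurable_service 0 m).coe_nnreal_real
  | succ j ih =>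
    exact ((Q.measurable_arrival (j + 1)).max ih).add
      (Q.measurable_service (j + 1) m).coe_nnreal_real

theorem measurable_sojourn (Q : ForkJoinQueue n P) (j : ℕ) : Measurable (Q.sojourn j) :=
  measurable_pi_lambda _ fun m => (Q.measurable_completion j m).sub (Q.measurable_arrival j)

theorem completion_canonical (Q : ForkJoinQueue n P) {l : ℕ} (e : Fin l → Fin n) (j : ℕ)
    (m : Fin l) (ω : Ω) :
    (canonical l).completion j m (Q.input e ω) = Q.completion j (e m) ω := by
  induction j with
  | zero => rfl
  | succ j ih => rw [completion, ih]; rfl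

/-- The sojourn times at the nodes `e 0, …, e (l - 1)` are a function of the input there. -/
theorem sojourn_canonical (Q : ForkJoinQueue n P) {l : ℕ} (e : Fin l → Fin n) (j : ℕ) :
    (canonical l).sojourn j ∘ Q.input e = fun ω => Q.sojourn j ω ∘ e := by
  funext ω m
  simp only [Function.comp_apply, sojourn, completion_canonical]
  rfl

theorem Equivalent.identDistrib_sojourn {Q : ForkJoinQueue n P} {R : ForkJoinQueue n' P'}
    (h : Q.Equivalent R) {l : ℕ} (e : Fin l ↪ Fin n) (f : Fin l ↪ Fin n') (j : ℕ) :
    IdentDistrib (fun ω => Q.sojourn j ω ∘ e) (fun ω => R.sojourn j ω ∘ f) P P' := by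
  rw [← Q.sojourn_canonical e j, ← R.sojourn_canonical f j]
  exact (h l e f).comp ((canonical l).measurable_sojourn j)

/-- All sub-tasks of a job share its arrival time, so subtracting it commutes with the order
statistic. -/
theorem jobSojourn_eq (Q : ForkJoinQueue n P) {k : ℕ} (hk : 1 ≤ k) (hkn : k ≤ n) (j : ℕ) :
    Q.jobSojourn k j = orderStat k ∘ Q.sojourn j :=
  funext fun _ => (orderStat_sub_const hk hkn _ _).symm

variable [IsProbabilityMeasure P] [IsProbabilityMeasure P']

theorem IsStableSojournLaw.tendsto_jobSojourn {Q : ForkJoinQueue n P}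
    {τ : Measure (Fin n → ℝ)} [IsProbabilityMeasure τ] (h : Q.IsStableSojournLaw τ)
    {k : ℕ} (hk : 1 ≤ k) (hkn : k ≤ n) :
    TendstoInDistribution (Q.jobSojourn k) atTop (orderStat k) (fun _ => P) τ := by
  have := TendstoInDistribution.continuous_comp (continuous_orderStat hk hkn) h
  rw [show Q.jobSojourn k = fun j => orderStat k ∘ Q.sojourn j from
    funext fun j => Q.jobSojourn_eq hk hkn j]
  exact this

theorem IsStableSojournLaw.tendsto_comp {Q : ForkJoinQueue n P}
    {τ : Measure (Fin n → ℝ)} [IsProbabilityMeasure τ] (h : Q.IsStableSojournLaw τ)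
    {l : ℕ} (e : Fin l → Fin n) :
    TendstoInDistribution (fun j ω => Q.sojourn j ω ∘ e) atTop (fun t => t ∘ e) (fun _ => P) τ :=
  TendstoInDistribution.continuous_comp (g := fun t : Fin n → ℝ => t ∘ e)
    (continuous_pi fun m => continuous_apply (e m)) h

/-- The marginals of the stable sojourn law of a homogeneous queue depend on their dimension
only. -/
theorem IsHomogeneous.map_comp_eq {Q : ForkJoinQueue n P} (hQ : Q.IsHomogeneous)
    {τ : Measure (Fin n → ℝ)} [IsProbabilityMeasure τ] (h : Q.IsStableSojournLaw τ)
    {l : ℕ} (e f : Fin l ↪ Fin n) :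
    τ.map (fun t => t ∘ e) = τ.map (fun t => t ∘ f) :=
  -- The laws along `e` and `f` agree at every job, so one sequence of laws has both limits.
  tendstoInDistribution_unique _
    (TendstoInDistribution.of_identDistrib (h.tendsto_comp e)
      (fun j => hQ.identDistrib_sojourn e f j)
      (IdentDistrib.refl (h.tendsto_comp e).aemeasurable_limit))
    (h.tendsto_comp f)

/-- A queue that is equivalent to a stable queue with at least as many nodes is stable. -/
theorem Equivalent.isStableSojournLaw {Q : ForkJoinQueue n P} {R : ForkJoinQueue n' P'}
    (hR : Q.Equivalent R) {τ : Measure (Fin n → ℝ)} [IsProbabilityMeasure τ]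
    (h : Q.IsStableSojournLaw τ) (e : Fin n' ↪ Fin n) {τ' : Measure (Fin n' → ℝ)}
    [IsProbabilityMeasure τ'] (hτ' : τ' = τ.map (fun t => t ∘ e)) : R.IsStableSojournLaw τ' := by
  have he := h.tendsto_comp e
  exact TendstoInDistribution.of_identDistrib he
    (fun j => hR.identDistrib_sojourn e (Function.Embedding.refl _) j)
    ⟨he.aemeasurable_limit, aemeasurable_id, by rw [Measure.map_id, hτ']⟩

end ForkJoinQueue

/-! ### The law of an order statistic -/

theorem measurable_comp_pi {n l : ℕ} (e : Fin l → Fin n) :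
    Measurable fun t : Fin n → ℝ => t ∘ e :=
  measurable_pi_lambda _ fun m => measurable_pi_apply (e m)

theorem measurableSet_forall_mem_le {n : ℕ} (I : Finset (Fin n)) (x : ℝ) :
    MeasurableSet {t : Fin n → ℝ | ∀ m ∈ I, t m ≤ x} := by
  simp only [Set.ofPred_forall]
  exact Finset.measurableSet_biInter I fun m _ =>
    measurableSet_le (measurable_pi_apply m) measurable_const

/-- The law of the `k`-th order statistic in terms of the laws of maxima. -/
theorem measureReal_orderStat_le {n k : ℕ} (hk : 1 ≤ k) (hkn : k ≤ n)
    (τ : Measure (Fin n → ℝ)) [IsProbabilityMeasure τ] (x : ℝ) :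
    τ.real {t | orderStat k t ≤ x} = ∑ i ∈ Icc k n, (altCoeff k i : ℝ) *
      ∑ I ∈ powersetCard i (univ : Finset (Fin n)), τ.real {t | ∀ m ∈ I, t m ≤ x} := by
  have hS : MeasurableSet {t : Fin n → ℝ | orderStat k t ≤ x} :=
    measurableSet_le (continuous_orderStat hk hkn).measurable measurable_const
  have hpt : ∀ t : Fin n → ℝ, {t : Fin n → ℝ | orderStat k t ≤ x}.indicator (1 : (Fin n → ℝ) → ℝ) t =
      ∑ i ∈ Icc k n, (altCoeff k i : ℝ) * ∑ I ∈ powersetCard i (univ : Finset (Fin n)),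
        {t : Fin n → ℝ | ∀ m ∈ I, t m ≤ x}.indicator (1 : (Fin n → ℝ) → ℝ) t := by
    intro t
    -- The subsets counted are the `i`-subsets of `{m | t m ≤ x}`.
    have hcard : ∀ i, ∑ I ∈ powersetCard i (univ : Finset (Fin n)),
        {t : Fin n → ℝ | ∀ m ∈ I, t m ≤ x}.indicator (1 : (Fin n → ℝ) → ℝ) t =
        ((#{m | t m ≤ x}).choose i : ℝ) := by
      intro i
      classical
      rw [← card_powersetCard, Finset.card_eq_sum_ones, Nat.cast_sum]
      have hsub : powersetCard i ({m | t m ≤ x} : Finset (Fin n)) =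
          {I ∈ powersetCard i (univ : Finset (Fin n)) | ∀ m ∈ I, t m ≤ x} := by
        ext I
        simp [mem_powersetCard, subset_iff, and_comm]
      rw [hsub, sum_filter]
      refine sum_congr rfl fun I _ => ?_
      simp [Set.indicator_apply]
    simp only [hcard]
    simp only [Set.indicator_apply, Set.mem_ofPred_eq, orderStat_le_iff hk hkn,
      Pi.one_apply]
    have := sum_choose_mul_altCoeff (k := k) (b := #{m | t m ≤ x}) (n := n)
      ((card_filter_le _ _).trans (by simp))
    exact_mod_cast this.symm
  have hint : ∀ I : Finset (Fin n), Integrable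
      ({t : Fin n → ℝ | ∀ m ∈ I, t m ≤ x}.indicator (1 : (Fin n → ℝ) → ℝ)) τ := fun I =>
    (integrable_const (1 : ℝ)).indicator (measurableSet_forall_mem_le I x)
  rw [← integral_indicator_one hS, integral_congr_ae (ae_of_all _ hpt), integral_finsetSum]
  · refine sum_congr rfl fun i _ => ?_
    rw [integral_const_mul, integral_finsetSum _ fun I _ => hint I]
    simp only [integral_indicator_one (measurableSet_forall_mem_le _ x)]
  · exact fun i _ => (integrable_finsetSum _ fun I _ => hint I).const_mul _

/-- If all `i`-dimensional marginals of `τ` are `τ'`, then the largest of any `i` coordinates under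
`τ` is distributed as the largest coordinate under `τ'`. -/
theorem measureReal_forall_mem_le {n i : ℕ} (hi : 1 ≤ i) {τ : Measure (Fin n → ℝ)}
    {τ' : Measure (Fin i → ℝ)} (h : ∀ e : Fin i ↪ Fin n, τ' = τ.map (fun t => t ∘ e))
    {I : Finset (Fin n)} (hI : #I = i) (x : ℝ) :
    τ.real {t | ∀ m ∈ I, t m ≤ x} = τ'.real {t | orderStat i t ≤ x} := by
  -- The increasing enumeration of `I` is an embedding with range `I`.
  rw [h (I.orderEmbOfFin hI).toEmbedding, map_measureReal_apply (measurable_comp_pi _)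
    (measurableSet_le (continuous_orderStat hi le_rfl).measurable measurable_const)]
  congr 1
  ext t
  simp only [Set.mem_ofPred_eq, Set.preimage_ofPred_eq, orderStat_self_le_iff hi]
  have hrange := Set.forall_mem_range (f := I.orderEmbOfFin hI) (p := fun m => t m ≤ x)
  rw [Finset.range_orderEmbOfFin] at hrange
  exact hrange

theorem theorem3 (n k : ℕ) (hk : 1 ≤ k) (hkn : k ≤ n)
    -- the general `(n, k)` fork-join queue `Q`
    {Ω : Type*} [MeasurableSpace Ω] (P : Measure Ω) [IsProbabilityMeasure P]
    (Q : ForkJoinQueue n P) (hQ : Q.IsHomogeneous)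
    -- the equivalent basic `(i, i)` fork-join queues `R i`, `k ≤ i ≤ n`
    {Ω' : ℕ → Type*} [∀ i, MeasurableSpace (Ω' i)] (P' : ∀ i, Measure (Ω' i))
    [∀ i, IsProbabilityMeasure (P' i)] (R : ∀ i, ForkJoinQueue i (P' i))
    (hR : ∀ i ∈ Finset.Icc k n, Q.Equivalent (R i))
    -- `Q` is stable: its sub-tasks have stationary sojourn times, of joint law `τ`
    (τ : Measure (Fin n → ℝ)) [IsProbabilityMeasure τ] (hτ : Q.IsStableSojournLaw τ) :
    -- the stationary job sojourn time `t_{(n,k)}` of `Q` is the `k`-th order statistic under `τ`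
    TendstoInDistribution (Q.jobSojourn k) atTop (orderStat k) (fun _ => P) τ ∧
    ∃ τ' : ∀ i, ProbabilityMeasure (Fin i → ℝ),
      -- so are `t_{(i,i)}`, the stationary job sojourn times of the basic queues
      (∀ i ∈ Finset.Icc k n, (R i).IsStableSojournLaw (τ' i : Measure (Fin i → ℝ)) ∧
        TendstoInDistribution ((R i).jobSojourn i) atTop (orderStat i) (fun _ => P' i)
          (τ' i : Measure (Fin i → ℝ))) ∧
      -- the law of `t_{(n,k)}` is the linear combination of those of the `t_{(i,i)}`
      ∀ x : ℝ, τ.real {t | orderStat k t ≤ x} =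
        ∑ i ∈ Finset.Icc k n,
          (coeffW n k i : ℝ) * (τ' i : Measure (Fin i → ℝ)).real {t | orderStat i t ≤ x} := by
  have hex : ∀ i, ∃ τ' : ProbabilityMeasure (Fin i → ℝ), i ≤ n →
      ∀ e : Fin i ↪ Fin n, (τ' : Measure (Fin i → ℝ)) = τ.map (fun t => t ∘ e) := by
    intro i
    by_cases hin : i ≤ n
    · exact ⟨⟨τ.map (fun t => t ∘ Fin.castLEEmb hin),
        Measure.isProbabilityMeasure_map (measurable_comp_pi _).aemeasurable⟩,
        fun _ e => hQ.map_comp_eq hτ (Fin.castLEEmb hin) e⟩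
    -- Filler, so that `τ'` is defined for every `i`.
    · exact ⟨⟨Measure.dirac 0, inferInstance⟩, fun h => absurd h hin⟩
  choose τ' hτ' using hex
  refine ⟨hτ.tendsto_jobSojourn hk hkn, τ', fun i hi => ?_, fun x => ?_⟩
  · obtain ⟨hki, hin⟩ := Finset.mem_Icc.1 hi
    have hst : (R i).IsStableSojournLaw (τ' i : Measure (Fin i → ℝ)) :=
      (hR i hi).isStableSojournLaw hτ (Fin.castLEEmb hin) (hτ' i hin _)
    exact ⟨hst, hst.tendsto_jobSojourn (hk.trans hki) le_rfl⟩
  · rw [measureReal_orderStat_le hk hkn]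
    refine Finset.sum_congr rfl fun i hi => ?_
    obtain ⟨hki, hin⟩ := Finset.mem_Icc.1 hi
    rw [Finset.sum_congr rfl fun I hI => measureReal_forall_mem_le (hk.trans hki) (hτ' i hin)
      (Finset.mem_powersetCard.1 hI).2 x, Finset.sum_const, Finset.card_powersetCard,
      Finset.card_univ, Fintype.card_fin, coeffW_eq hin]
    push_cast
    rw [nsmul_eq_mul]
    ring
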